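/- Let $d \ge 1$ and $m \ge 0$ be integers, and let $L_1, \dots, L_m \in M_d(\mathbb{C})$ be (not necessarily traceless) complex $d \times d$ matrices. Let $\mathcal{D} = \sum_{j=1}^m \mathcal{D}_{L_j}$ be the associated dissipator on $M_d(\mathbb{C})$, where $$\mathcal{D}_L(x) = L x L^\dagger - \tfrac12\left(L^\dagger L x + x L^\dagger L\right).$$ A state is a positive semidefinite matrix $\rho \in M_d(\mathbb{C})$ with $\operatorname{tr}\rho = 1$, a fixed point of $\mathcal{D}$ is a state $\sigma$ with $\mathcal{D}(\sigma) = 0$, and $\|\cdot\|_1$ is the trace norm (the sum of the singular values). For a time-dependent Hamiltonian $H : \mathbb{R} \to M_d(\mathbb{C})$ with $H(t) = H(t)^\dagger$ for all $t$ and with locally integrable entries, put $\mathcal{L}_t = -i[H(t), \,\cdot\,] + \mathcal{D}$, and let $\mathcal{E}_{t,s} = \mathcal{T}\exp\left(\int_s^t \mathcal{L}_u\,du\right)$ be its time evolution, i.e. the sum of the time-ordered exponential series $$\mathcal{E}_{t,s} = \sum_{n \ge 0} \int_{s \le u_1 \le \dots \le u_n \le t} \mathcal{L}_{u_n} \cdots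 \mathcal{L}_{u_1} \, du_1 \cdots du_n .$$ $\mathcal{L}_t$ is called exponentially contractive if there are constants $K, \gamma > 0$ such that $\|\mathcal{E}_{t,s}(\rho - \sigma)\|_1 \le K e^{-\gamma |t-s|} \|\rho - \sigma\|_1$ for all states $\rho, \sigma$ and all $t \ge s \ge 0$. The dissipator $\mathcal{D}$ is called Hamiltonian-independently contractive if $\mathcal{L}_t = -i[H(t),\,\cdot\,] + \mathcal{D}$ is exponentially contractive for every such $H$ (the constants $K, \gamma$ may depend on $H$). Assume that $\mathcal{D}$ is unital, i.e. $\mathcal{D}(I) = 0$. Then the following three conditions are equivalent: 1. $\mathcal{D}$ is Hamiltonian-independently contractive. 2. $\tau = I/d$ is the unique fixed point of $\mathcal{D}$. 3. The set $\{L_j, L_j^\dagger\}_{j=1}^m$ generates, as a unital complex algebra, the full matrix algebra $M_d(\mathbb{C})$. -/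

import Mathlib

open scoped Matrix ComplexOrder

noncomputable section

/-- A quantum state on `ℂ^d`: a positive semidefinite matrix of trace `1`. -/
def IsQuantumState {d : ℕ} (ρ : Matrix (Fin d) (Fin d) ℂ) : Prop :=
  ρ.PosSemidef ∧ ρ.trace = 1

/-- The maximally mixed state `τ = I / d`. -/
def maximallyMixed (d : ℕ) : Matrix (Fin d) (Fin d) ℂ :=
  (d : ℂ)⁻¹ • 1

/-- The trace norm (Schatten 1-norm): the sum of the singular values of `A`, which are the square
roots of the eigenvalues of `Aᴴ * A`. -/
def traceNorm {d : ℕ} (A : Matrix (Fin d) (Fin d) ℂ) : ℝ :=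
  ∑ k, √((Matrix.isHermitian_conjTranspose_mul_self A).eigenvalues k)

/-- The dissipator of a single jump operator: `𝓓_L(x) = L x L† - {L† L, x} / 2`. -/
def jumpDissipator {d : ℕ} (L : Matrix (Fin d) (Fin d) ℂ) :
    Matrix (Fin d) (Fin d) ℂ →ₗ[ℂ] Matrix (Fin d) (Fin d) ℂ where
  toFun x := L * x * Lᴴ - (1 / 2 : ℂ) • (Lᴴ * L * x + x * (Lᴴ * L))
  map_add' x y := by
    simp only [mul_add, add_mul, smul_add]
    abel
  map_smul' c x := by
    simp only [mul_smul_comm, smul_mul_assoc, smul_sub, smul_add, RingHom.id_apply, smul_comm c]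

/-- The dissipator `𝓓 = ∑ j, 𝓓_{L_j}` of a finite family of jump operators. -/
def dissipator {d m : ℕ} (L : Fin m → Matrix (Fin d) (Fin d) ℂ) :
    Matrix (Fin d) (Fin d) ℂ →ₗ[ℂ] Matrix (Fin d) (Fin d) ℂ :=
  ∑ j, jumpDissipator (L j)

/-- The Hamiltonian part of a Lindbladian: `x ↦ -i [H, x]`. -/
def hamiltonianPart {d : ℕ} (H : Matrix (Fin d) (Fin d) ℂ) :
    Matrix (Fin d) (Fin d) ℂ →ₗ[ℂ] Matrix (Fin d) (Fin d) ℂ where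
  toFun x := (-Complex.I) • (H * x - x * H)
  map_add' x y := by
    simp only [mul_add, add_mul, smul_add, smul_sub]
    abel
  map_smul' c x := by
    simp only [mul_smul_comm, smul_mul_assoc, smul_sub, RingHom.id_apply,
      smul_comm c (-Complex.I)]

/-- The driven Lindbladian `𝓛_t = -i [H(t), · ] + 𝓓`. -/
def drivenLindbladian {d : ℕ} (H : ℝ → Matrix (Fin d) (Fin d) ℂ)
    (D : Matrix (Fin d) (Fin d) ℂ →ₗ[ℂ] Matrix (Fin d) (Fin d) ℂ) (t : ℝ) :
    Matrix (Fin d) (Fin d) ℂ →ₗ[ℂ] Matrix (Fin d) (Fin d) ℂ :=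
  hamiltonianPart (H t) + D

/-- The `n`-th term of the time-ordered exponential of `𝓛` from time `s` to time `t`, applied to
`x`:
`∫_{s ≤ u₁ ≤ … ≤ uₙ ≤ t} 𝓛_{uₙ} ⋯ 𝓛_{u₁} x du₁ ⋯ duₙ`,
as an iterated integral (entry by entry) whose outermost variable is the latest time. -/
def dysonTerm {d : ℕ}
    (𝓛 : ℝ → Matrix (Fin d) (Fin d) ℂ →ₗ[ℂ] Matrix (Fin d) (Fin d) ℂ)
    (s : ℝ) (x : Matrix (Fin d) (Fin d) ℂ) : ℕ → ℝ → Matrix (Fin d) (Fin d) ℂ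
  | 0, _ => x
  | n + 1, t => Matrix.of fun i j => ∫ u in s..t, (𝓛 u (dysonTerm 𝓛 s x n u)) i j

/-- The time evolution `𝓔_{t,s}(x)`, where `𝓔_{t,s} = 𝓣 exp (∫_s^t 𝓛_u du)` is the time-ordered
exponential. -/
def timeEvolution {d : ℕ}
    (𝓛 : ℝ → Matrix (Fin d) (Fin d) ℂ →ₗ[ℂ] Matrix (Fin d) (Fin d) ℂ)
    (t s : ℝ) (x : Matrix (Fin d) (Fin d) ℂ) : Matrix (Fin d) (Fin d) ℂ :=
  ∑' n : ℕ, dysonTerm 𝓛 s x n t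

/-- Exponential contractivity of a time-dependent Lindbladian. -/
def IsExponentiallyContractive {d : ℕ}
    (𝓛 : ℝ → Matrix (Fin d) (Fin d) ℂ →ₗ[ℂ] Matrix (Fin d) (Fin d) ℂ) : Prop :=
  ∃ K γ : ℝ, 0 < K ∧ 0 < γ ∧
    ∀ ρ σ : Matrix (Fin d) (Fin d) ℂ, IsQuantumState ρ → IsQuantumState σ →
      ∀ s t : ℝ, 0 ≤ s → s ≤ t →
        traceNorm (timeEvolution 𝓛 t s (ρ - σ)) ≤
          K * Real.exp (-γ * |t - s|) * traceNorm (ρ - σ)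

/-- A time-dependent Hamiltonian: Hermitian at all times, with locally integrable components. -/
def IsDrivingHamiltonian {d : ℕ} (H : ℝ → Matrix (Fin d) (Fin d) ℂ) : Prop :=
  (∀ t, (H t).IsHermitian) ∧
    ∀ i j, MeasureTheory.LocallyIntegrable (fun t => H t i j) MeasureTheory.volume

/-- Hamiltonian-independent contractivity of a dissipator: every driven Lindbladian
`-i [H(t), · ] + 𝓓` is exponentially contractive. -/
def IsHamiltonianIndependentlyContractive {d : ℕ}
    (D : Matrix (Fin d) (Fin d) ℂ →ₗ[ℂ] Matrix (Fin d) (Fin d) ℂ) : Prop :=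
  ∀ H : ℝ → Matrix (Fin d) (Fin d) ℂ, IsDrivingHamiltonian H →
    IsExponentiallyContractive (drivenLindbladian H D)

/-- A fixed point of a constant Lindbladian: a quantum state that it annihilates. -/
def IsFixedState {d : ℕ}
    (D : Matrix (Fin d) (Fin d) ℂ →ₗ[ℂ] Matrix (Fin d) (Fin d) ℂ)
    (ρ : Matrix (Fin d) (Fin d) ℂ) : Prop :=
  IsQuantumState ρ ∧ D ρ = 0

end

/-! The argument runs 1 → 2 → 3 → 1, and rests on the identity `sum_frobeniusSq_commutator`: for
unital `𝓓`, `-2 Re tr(x† 𝓓 x) = ∑ ‖[L_j, x]‖²` in the Hilbert–Schmidt norm. For 3 → 1, equality of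
this sum for `L_j` and `L_j†` shows that whatever commutes with every `L_j` commutes with every
`L_j†`, hence with the full algebra. A traceless such matrix is `0`, so in finite dimension the sum
dominates a positive multiple of `‖x‖²` on traceless `x` (`exists_gap`). The Hamiltonian part
contributes nothing to `Re tr(x† 𝓛 x)`, so Grönwall gives decay at a rate independent of `H`;
comparison with the trace norm costs a factor `√d`. As `H` is only locally integrable, Grönwall is
run on absolutely continuous functions. For 2 → 3, each nonzero `y` in the commutant of `{L_j,
L_j†}` gives a fixed state proportional to `y† y`. Uniqueness and polarization make the commutant
scalar, and Jacobson density concludes. For 1 → 2, take `H = 0`: a difference of two fixed states is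
stationary, yet must decay. -/

open Module in
/-- A self-adjoint algebra of operators on a finite-dimensional Hilbert space whose commutant is
trivial is the algebra of all operators. -/
theorem Subalgebra.eq_top_of_commutant_trivial {V : Type*} [NormedAddCommGroup V]
    [InnerProductSpace ℂ V] [FiniteDimensional ℂ V] (A : Subalgebra ℂ (V →L[ℂ] V))
    (hstar : ∀ a ∈ A, star a ∈ A)
    (hcomm : ∀ x : V →L[ℂ] V, (∀ a ∈ A, a * x = x * a) → ∃ c : ℂ, x = c • 1) : A = ⊤ := by
  have : IsScalarTower ℂ A V := ⟨fun _ _ _ => rfl⟩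
  have hsemi : IsSemisimpleModule A V := by
    refine (isSemisimpleModule_iff _ _).mpr ⟨fun W => ?_⟩
    let W₀ : Submodule ℂ V := W.restrictScalars ℂ
    -- The orthogonal complement of an invariant subspace is invariant because the algebra contains
    -- the adjoints of its elements.
    let W' : Submodule A V :=
      { carrier := W₀ᗮ
        add_mem' := fun ha hb => W₀ᗮ.add_mem ha hb
        zero_mem' := W₀ᗮ.zero_mem
        smul_mem' := fun a v hv => by
          intro w hw
          have h1 : (⟨star (a : V →L[ℂ] V), hstar _ a.2⟩ : A) • w ∈ W := W.smul_mem _ hw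
          have h2 := hv _ h1
          change inner ℂ ((star (a : V →L[ℂ] V)) w) v = 0 at h2
          change inner ℂ w ((a : V →L[ℂ] V) v) = 0
          rw [ContinuousLinearMap.star_eq_adjoint, ContinuousLinearMap.adjoint_inner_left] at h2
          exact h2 }
    have hc : IsCompl W₀ W₀ᗮ := Submodule.isCompl_orthogonal _
    refine ⟨W', ?_, ?_⟩
    · rw [Submodule.disjoint_def]
      exact fun x hx hx' => Submodule.disjoint_def.mp hc.disjoint x hx hx'
    · rw [codisjoint_iff, eq_top_iff]
      intro x _
      obtain ⟨y, hy, z, hz, rfl⟩ := Submodule.mem_sup.mp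
        ((codisjoint_iff.mp hc.codisjoint).ge (Submodule.mem_top (x := x)))
      exact Submodule.mem_sup.mpr ⟨y, hy, z, hz, rfl⟩
  rw [eq_top_iff]
  intro T _
  -- `A`-linear endomorphisms of `V` lie in the commutant, so they are scalars and `T` commutes with
  -- all of them. Density then gives an element of `A` agreeing with `T` on a basis.
  let f : End (End A V) V :=
    { toFun := T
      map_add' := map_add T
      map_smul' := fun g v => by
        obtain ⟨c, hc⟩ := hcomm (LinearMap.toContinuousLinearMap (g.restrictScalars ℂ))
          (fun a ha => by
            ext v
            exact (g.map_smul (⟨a, ha⟩ : A) v).symm)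
        have hg : ∀ w, g w = c • w := fun w => by
          simpa using congr($hc w)
        simp [hg] }
  classical
  let b := Module.finBasis ℂ V
  obtain ⟨r, hr⟩ := jacobson_density f (Finset.univ.image b)
  have : T = (r : V →L[ℂ] V) := by
    apply ContinuousLinearMap.coe_injective
    refine b.ext fun i => ?_
    exact hr (b i) (Finset.mem_image_of_mem _ (Finset.mem_univ _))
  rw [this]
  exact r.2

/-- A self-adjoint set of matrices with trivial commutant generates the full matrix algebra. -/
theorem Matrix.adjoin_eq_top_of_commutant_trivial {d : ℕ} (S : Set (Matrix (Fin d) (Fin d) ℂ))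
    (hstar : ∀ a ∈ S, aᴴ ∈ S)
    (hcomm : ∀ x : Matrix (Fin d) (Fin d) ℂ, (∀ a ∈ S, a * x = x * a) → ∃ c : ℂ, x = c • 1) :
    Algebra.adjoin ℂ S = ⊤ := by
  let e := Matrix.toEuclideanCLM (n := Fin d) (𝕜 := ℂ)
  have h := Subalgebra.eq_top_of_commutant_trivial
    ((Algebra.adjoin ℂ S).map e.toAlgEquiv.toAlgHom) ?_ ?_
  · rw [eq_top_iff]
    intro x _
    obtain ⟨y, hy, hyx⟩ := h.ge (Algebra.mem_top (x := e x))
    rwa [← e.injective hyx]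
  · rintro _ ⟨a, ha, rfl⟩
    refine ⟨star a, ?_, map_star e a⟩
    have h1 : star a ∈ star (Algebra.adjoin ℂ S) := by simpa using ha
    rw [Subalgebra.star_adjoin_comm] at h1
    refine Algebra.adjoin_mono ?_ h1
    intro b hb
    have := hstar _ hb
    rwa [← Matrix.star_eq_conjTranspose, star_star] at this
  · intro x hx
    obtain ⟨c, hc⟩ := hcomm (e.symm x) (fun a ha => by
      refine e.injective (show e (a * e.symm x) = e (e.symm x * a) from ?_)
      have h1 := hx (e a) ⟨a, Algebra.subset_adjoin ha, rfl⟩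
      rwa [map_mul, map_mul, StarAlgEquiv.apply_symm_apply])
    refine ⟨c, ?_⟩
    rw [← e.apply_symm_apply x, hc, map_smul, map_one]

/-! ### Dissipation identity, commutant and spectral gap -/

section Dissipator

variable {d m : ℕ}

theorem dissipator_apply (L : Fin m → Matrix (Fin d) (Fin d) ℂ) (x : Matrix (Fin d) (Fin d) ℂ) :
    dissipator L x =
      ∑ j, (L j * x * (L j)ᴴ - (1 / 2 : ℂ) • ((L j)ᴴ * L j * x + x * ((L j)ᴴ * L j))) := by
  simp [dissipator, jumpDissipator]

theorem sum_mul_conjTranspose_eq_of_dissipator_one {L : Fin m → Matrix (Fin d) (Fin d) ℂ}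
    (h : dissipator L 1 = 0) : ∑ j, L j * (L j)ᴴ = ∑ j, (L j)ᴴ * L j := by
  rw [dissipator_apply] at h
  rw [← sub_eq_zero, ← Finset.sum_sub_distrib, ← h]
  refine Finset.sum_congr rfl fun j _ => ?_
  rw [mul_one, mul_one, one_mul, ← two_smul ℂ ((L j)ᴴ * L j), smul_smul]
  norm_num

/-- The squared Hilbert–Schmidt norm. -/
noncomputable def frobeniusSq (x : Matrix (Fin d) (Fin d) ℂ) : ℝ := ∑ i, ∑ j, ‖x i j‖ ^ 2

theorem trace_conjTranspose_mul_self (x : Matrix (Fin d) (Fin d) ℂ) :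
    (xᴴ * x).trace = (frobeniusSq x : ℂ) := by
  simp only [Matrix.trace, Matrix.diag, Matrix.mul_apply, Matrix.conjTranspose_apply, frobeniusSq,
    Complex.ofReal_sum, Complex.ofReal_pow]
  rw [Finset.sum_comm]
  refine Finset.sum_congr rfl fun i _ => Finset.sum_congr rfl fun j _ => ?_
  rw [mul_comm, RCLike.star_def, Complex.mul_conj, Complex.normSq_eq_norm_sq]
  simp

theorem frobeniusSq_nonneg (x : Matrix (Fin d) (Fin d) ℂ) : 0 ≤ frobeniusSq x :=
  Finset.sum_nonneg fun _ _ => Finset.sum_nonneg fun _ _ => by positivity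

theorem frobeniusSq_eq_zero {x : Matrix (Fin d) (Fin d) ℂ} (h : frobeniusSq x = 0) : x = 0 := by
  ext i j
  have h1 := (Finset.sum_eq_zero_iff_of_nonneg
    (fun _ _ => Finset.sum_nonneg fun _ _ => by positivity)).mp h i (Finset.mem_univ _)
  have h2 := (Finset.sum_eq_zero_iff_of_nonneg (fun _ _ => by positivity)).mp h1 j
    (Finset.mem_univ _)
  simpa using h2

theorem trace_commutator_sq (a x : Matrix (Fin d) (Fin d) ℂ) :
    ((a * x - x * a)ᴴ * (a * x - x * a)).trace =
      (xᴴ * (aᴴ * a) * x).trace + (xᴴ * x * (a * aᴴ)).trace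
        - (xᴴ * (a * x * aᴴ)).trace - star (xᴴ * (a * x * aᴴ)).trace := by
  have h1 : (xᴴ * aᴴ * x * a).trace = (a * (xᴴ * aᴴ * x)).trace := Matrix.trace_mul_comm _ _
  have h2 : (aᴴ * (xᴴ * a * x)).trace = (xᴴ * a * x * aᴴ).trace := Matrix.trace_mul_comm _ _
  have h3 : (aᴴ * (xᴴ * x * a)).trace = (xᴴ * x * a * aᴴ).trace := Matrix.trace_mul_comm _ _
  rw [← Matrix.trace_conjTranspose]
  simp only [Matrix.conjTranspose_sub, Matrix.conjTranspose_mul, Matrix.conjTranspose_conjTranspose,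
    sub_mul, mul_sub, Matrix.trace_sub, Matrix.mul_assoc] at h1 h2 h3 ⊢
  rw [h1, h2, h3]
  ring

/-- Expanding `‖[L_j, x]‖²` produces `tr(x† x L_j L_j†)` where the dissipator has `tr(x† x L_j†
L_j)`; unitality equates the two after summing over `j`. -/
theorem sum_frobeniusSq_commutator {L : Fin m → Matrix (Fin d) (Fin d) ℂ}
    (h : dissipator L 1 = 0) (x : Matrix (Fin d) (Fin d) ℂ) :
    ∑ j, frobeniusSq (L j * x - x * L j) = -2 * (xᴴ * dissipator L x).trace.re := by
  have hS := congr((xᴴ * x * $(sum_mul_conjTranspose_eq_of_dissipator_one h)).trace.re)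
  have h1 : ∀ j, frobeniusSq (L j * x - x * L j) = (xᴴ * ((L j)ᴴ * L j) * x).trace.re +
      (xᴴ * x * (L j * (L j)ᴴ)).trace.re - 2 * (xᴴ * (L j * x * (L j)ᴴ)).trace.re := by
    intro j
    have h2 := congr(Complex.re $(trace_commutator_sq (L j) x))
    rw [trace_conjTranspose_mul_self] at h2
    simp only [Complex.ofReal_re, Complex.sub_re, Complex.add_re, RCLike.star_def,
      Complex.conj_re] at h2
    rw [h2]
    ring
  simp only [Finset.mul_sum, Matrix.trace_sum, Complex.re_sum] at hS
  simp only [h1, dissipator_apply, Finset.mul_sum, Matrix.trace_sum, Complex.re_sum,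
    Finset.sum_sub_distrib, Finset.sum_add_distrib, hS, mul_sub, Matrix.trace_sub, Complex.sub_re,
    Matrix.mul_smul, Matrix.trace_smul, mul_add, Matrix.trace_add, smul_add, Complex.add_re]
  have h3 : ∀ z : ℂ, ((1 / 2 : ℂ) • z).re = 1 / 2 * z.re := fun z => by
    simp [Complex.mul_re]
  simp only [h3, ← Finset.mul_sum, Matrix.mul_assoc]
  ring

theorem dissipator_conjTranspose (L : Fin m → Matrix (Fin d) (Fin d) ℂ)
    (x : Matrix (Fin d) (Fin d) ℂ) : dissipator L xᴴ = (dissipator L x)ᴴ := by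
  simp only [dissipator_apply, Matrix.conjTranspose_sum, Matrix.conjTranspose_sub,
    Matrix.conjTranspose_smul, Matrix.conjTranspose_add, Matrix.conjTranspose_mul,
    Matrix.conjTranspose_conjTranspose, Matrix.mul_assoc]
  refine Finset.sum_congr rfl fun j _ => ?_
  rw [add_comm]
  simp

theorem frobeniusSq_conjTranspose (x : Matrix (Fin d) (Fin d) ℂ) :
    frobeniusSq xᴴ = frobeniusSq x := by
  simp only [frobeniusSq, Matrix.conjTranspose_apply, norm_star]
  exact Finset.sum_comm

theorem frobeniusSq_neg (x : Matrix (Fin d) (Fin d) ℂ) : frobeniusSq (-x) = frobeniusSq x := by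
  simp [frobeniusSq]

/-- `[L†, x] = -[L, x†]†`, and `Re tr(x† 𝓓 x)` is unchanged when `x` is replaced by `x†`, since `𝓓`
preserves adjoints. -/
theorem sum_frobeniusSq_commutator_conjTranspose {L : Fin m → Matrix (Fin d) (Fin d) ℂ}
    (h : dissipator L 1 = 0) (x : Matrix (Fin d) (Fin d) ℂ) :
    ∑ j, frobeniusSq ((L j)ᴴ * x - x * (L j)ᴴ) = ∑ j, frobeniusSq (L j * x - x * L j) := by
  have h1 : ∀ j, frobeniusSq ((L j)ᴴ * x - x * (L j)ᴴ) =
      frobeniusSq (L j * xᴴ - xᴴ * L j) := by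
    intro j
    rw [← frobeniusSq_conjTranspose, ← frobeniusSq_neg]
    congr 1
    simp
  simp only [h1]
  rw [sum_frobeniusSq_commutator h, sum_frobeniusSq_commutator h, dissipator_conjTranspose,
    ← Matrix.conjTranspose_mul, Matrix.trace_conjTranspose, Matrix.trace_mul_comm,
    RCLike.star_def, Complex.conj_re]

theorem commute_conjTranspose_of_commute {L : Fin m → Matrix (Fin d) (Fin d) ℂ}
    (h : dissipator L 1 = 0) {x : Matrix (Fin d) (Fin d) ℂ} (hx : ∀ j, L j * x = x * L j)
    (j : Fin m) : (L j)ᴴ * x = x * (L j)ᴴ := by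
  have h1 := sum_frobeniusSq_commutator_conjTranspose h x
  have h2 : ∑ j, frobeniusSq (L j * x - x * L j) = 0 :=
    Finset.sum_eq_zero fun j _ => by simp [hx j, frobeniusSq]
  rw [h2, Finset.sum_eq_zero_iff_of_nonneg fun _ _ => frobeniusSq_nonneg _] at h1
  exact sub_eq_zero.mp (frobeniusSq_eq_zero (h1 j (Finset.mem_univ _)))

theorem dissipator_eq_zero_of_commute {L : Fin m → Matrix (Fin d) (Fin d) ℂ}
    (h : dissipator L 1 = 0) {x : Matrix (Fin d) (Fin d) ℂ} (hx : ∀ j, L j * x = x * L j)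
    (hx' : ∀ j, (L j)ᴴ * x = x * (L j)ᴴ) : dissipator L x = 0 := by
  have h1 : dissipator L x = x * dissipator L 1 := by
    simp only [dissipator_apply, Finset.mul_sum]
    refine Finset.sum_congr rfl fun j _ => ?_
    have h2 : (L j)ᴴ * L j * x = x * ((L j)ᴴ * L j) := by
      rw [Matrix.mul_assoc, hx, ← Matrix.mul_assoc, hx', Matrix.mul_assoc]
    rw [h2, hx]
    simp only [mul_one, one_mul, mul_sub, mul_smul_comm, mul_add, Matrix.mul_assoc]
  rw [h1, h, mul_zero]

theorem isFixedState_maximallyMixed (hd : 0 < d) {L : Fin m → Matrix (Fin d) (Fin d) ℂ}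
    (h : dissipator L 1 = 0) : IsFixedState (dissipator L) (maximallyMixed d) := by
  have : (d : ℂ) ≠ 0 := by exact_mod_cast hd.ne'
  refine ⟨⟨Matrix.PosSemidef.one.smul (by positivity), ?_⟩, ?_⟩
  · simp [maximallyMixed, this]
  · rw [maximallyMixed, map_smul, h, smul_zero]

/-- If the maximally mixed state is the only fixed state, then the commutant is trivial. -/
theorem scalar_of_commute_of_unique_fixedState {L : Fin m → Matrix (Fin d) (Fin d) ℂ}
    (h : dissipator L 1 = 0)
    (huniq : ∀ ρ, IsFixedState (dissipator L) ρ → ρ = maximallyMixed d)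
    {x : Matrix (Fin d) (Fin d) ℂ} (hx : ∀ j, L j * x = x * L j)
    (hx' : ∀ j, (L j)ᴴ * x = x * (L j)ᴴ) : ∃ c : ℂ, x = c • 1 := by
  -- The commutant is closed under products and adjoints, so `y† y` lies in it and is killed by `𝓓`;
  -- its trace normalizes it to a fixed state.
  have key : ∀ y : Matrix (Fin d) (Fin d) ℂ, (∀ j, L j * y = y * L j) →
      (∀ j, (L j)ᴴ * y = y * (L j)ᴴ) → ∃ c : ℂ, yᴴ * y = c • 1 := by
    intro y hy hy'
    by_cases h0 : frobeniusSq y = 0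
    · exact ⟨0, by simp [frobeniusSq_eq_zero h0]⟩
    have h0' : (frobeniusSq y : ℂ) ≠ 0 := by exact_mod_cast h0
    have h1 : ∀ j, L j * yᴴ = yᴴ * L j := fun j => by
      simpa using congr($(hy' j)ᴴ).symm
    have h2 : ∀ j, (L j)ᴴ * yᴴ = yᴴ * (L j)ᴴ := fun j => by
      simpa using congr($(hy j)ᴴ).symm
    have h3 := huniq ((frobeniusSq y : ℂ)⁻¹ • (yᴴ * y)) ⟨⟨?_, ?_⟩, ?_⟩
    · refine ⟨frobeniusSq y * (d : ℂ)⁻¹, ?_⟩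
      rw [← smul_smul, ← maximallyMixed, ← h3, smul_smul, mul_inv_cancel₀ h0', one_smul]
    · refine (Matrix.posSemidef_conjTranspose_mul_self y).smul ?_
      rw [← Complex.ofReal_inv]
      exact_mod_cast inv_nonneg.mpr (frobeniusSq_nonneg y)
    · rw [Matrix.trace_smul, trace_conjTranspose_mul_self, smul_eq_mul, inv_mul_cancel₀ h0']
    · rw [map_smul, dissipator_eq_zero_of_commute h, smul_zero]
      · intro j
        rw [← Matrix.mul_assoc, h1, Matrix.mul_assoc, hy, Matrix.mul_assoc]
      · intro j
        rw [← Matrix.mul_assoc, h2, Matrix.mul_assoc, hy', Matrix.mul_assoc]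
  -- Polarization: comparing `y† y` at `y = x`, `x + 1` and `x + i` shows that `x + x†` and `i(x† -
  -- x)` are scalar, hence so is `x`.
  have shift : ∀ a : ℂ, ∃ c : ℂ, (x + a • 1)ᴴ * (x + a • 1) = c • 1 := fun a =>
    key _ (fun j => by simp [mul_add, add_mul, hx]) (fun j => by simp [mul_add, add_mul, hx'])
  obtain ⟨c₀, h0⟩ := key x hx hx'
  obtain ⟨c₁, h1⟩ := shift 1
  obtain ⟨c₂, h2⟩ := shift Complex.I
  refine ⟨(1 / 2) * ((c₁ - c₀ - 1) + Complex.I * (c₂ - c₀ - 1)), ?_⟩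
  simp only [Matrix.conjTranspose_add, Matrix.conjTranspose_smul, Matrix.conjTranspose_one,
    add_mul, mul_add, h0, smul_mul_assoc, one_mul, mul_smul_comm, mul_one, star_one,
    RCLike.star_def, Complex.conj_I] at h1 h2
  ext i j
  have e1 := congr($h1 i j)
  have e2 := congr($h2 i j)
  simp only [Matrix.add_apply, Matrix.smul_apply, smul_eq_mul, Matrix.conjTranspose_apply] at *
  have hI := Complex.I_mul_I
  linear_combination (1 / 2 : ℂ) * e1 + (1 / 2 : ℂ) * Complex.I * e2 +
    (1 / 2 : ℂ) * (x i j - star (x j i) + Complex.I * (1 : Matrix (Fin d) (Fin d) ℂ) i j) * hI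

theorem adjoin_eq_top_of_unique_fixedState {L : Fin m → Matrix (Fin d) (Fin d) ℂ}
    (h : dissipator L 1 = 0)
    (huniq : ∀ ρ, IsFixedState (dissipator L) ρ → ρ = maximallyMixed d) :
    Algebra.adjoin ℂ (Set.range L ∪ Set.range fun j => (L j)ᴴ) = ⊤ := by
  refine Matrix.adjoin_eq_top_of_commutant_trivial _ ?_ fun x hx =>
    scalar_of_commute_of_unique_fixedState h huniq (fun j => hx _ (Or.inl ⟨j, rfl⟩))
      (fun j => hx _ (Or.inr ⟨j, rfl⟩))
  rintro _ (⟨j, rfl⟩ | ⟨j, rfl⟩)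
  · exact Or.inr ⟨j, rfl⟩
  · exact Or.inl ⟨j, by simp⟩

/-- Unitality extends commutation to the adjoints, so `x` is central, hence scalar; a traceless
scalar vanishes because `d ≠ 0`. -/
theorem eq_zero_of_commute_of_adjoin_eq_top (hd : 0 < d) {L : Fin m → Matrix (Fin d) (Fin d) ℂ}
    (h : dissipator L 1 = 0)
    (hL : Algebra.adjoin ℂ (Set.range L ∪ Set.range fun j => (L j)ᴴ) = ⊤)
    {x : Matrix (Fin d) (Fin d) ℂ} (hx : ∀ j, L j * x = x * L j) (htr : x.trace = 0) : x = 0 := by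
  have h1 : Set.range L ∪ (Set.range fun j => (L j)ᴴ) ⊆ Subalgebra.centralizer ℂ {x} := by
    rintro _ (⟨j, rfl⟩ | ⟨j, rfl⟩)
    · rintro _ rfl
      exact (hx j).symm
    · rintro _ rfl
      exact (commute_conjTranspose_of_commute h hx j).symm
  have h2 := Algebra.adjoin_le h1
  rw [hL] at h2
  obtain ⟨c, rfl⟩ := Matrix.mem_range_scalar_iff_commute_single'.mpr fun i j =>
    (h2 (Algebra.mem_top (x := Matrix.single i j (1 : ℂ))) x rfl).symm
  have : (d : ℂ) ≠ 0 := by exact_mod_cast hd.ne'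
  simp [Matrix.scalar_apply, Matrix.trace_diagonal, this] at htr
  simp [htr]

section Coercivity

attribute [local instance] Matrix.normedAddCommGroup Matrix.normedSpace

theorem frobeniusSq_le_norm_sq (x : Matrix (Fin d) (Fin d) ℂ) :
    frobeniusSq x ≤ d * (d * ‖x‖ ^ 2) := by
  calc frobeniusSq x ≤ ∑ _i : Fin d, ∑ _j : Fin d, ‖x‖ ^ 2 := by
        unfold frobeniusSq
        gcongr
        exact Matrix.norm_entry_le_entrywise_sup_norm x
    _ = _ := by simp

theorem norm_sq_le_frobeniusSq (x : Matrix (Fin d) (Fin d) ℂ) : ‖x‖ ^ 2 ≤ frobeniusSq x := by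
  rw [← Real.le_sqrt (norm_nonneg _) (frobeniusSq_nonneg _),
    Matrix.norm_le_iff (Real.sqrt_nonneg _)]
  intro i j
  rw [Real.le_sqrt (norm_nonneg _) (frobeniusSq_nonneg _)]
  exact (Finset.single_le_sum (f := fun j => ‖x i j‖ ^ 2) (fun _ _ => by positivity)
    (Finset.mem_univ j)).trans (Finset.single_le_sum (f := fun i => ∑ j, ‖x i j‖ ^ 2)
      (fun _ _ => Finset.sum_nonneg fun _ _ => by positivity) (Finset.mem_univ i))

/-- Spectral gap: the dissipation is bounded below on traceless matrices. -/
theorem exists_gap (hd : 0 < d) {L : Fin m → Matrix (Fin d) (Fin d) ℂ}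
    (h : dissipator L 1 = 0)
    (hL : Algebra.adjoin ℂ (Set.range L ∪ Set.range fun j => (L j)ᴴ) = ⊤) :
    ∃ γ : ℝ, 0 < γ ∧ ∀ x : Matrix (Fin d) (Fin d) ℂ, x.trace = 0 →
      2 * γ * frobeniusSq x ≤ ∑ j, frobeniusSq (L j * x - x * L j) := by
  -- The trace coordinate makes `Φ` injective on all matrices. An injective linear map in finite
  -- dimension is bounded below, and on traceless `x` only the commutator coordinates remain.
  let Φ : Matrix (Fin d) (Fin d) ℂ →ₗ[ℂ] (Fin m → Matrix (Fin d) (Fin d) ℂ) × ℂ :=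
    (LinearMap.pi fun j => LinearMap.mulLeft ℂ (L j) - LinearMap.mulRight ℂ (L j)).prod
      (Matrix.traceLinearMap (Fin d) ℂ ℂ)
  have hker : LinearMap.ker Φ = ⊥ := by
    rw [LinearMap.ker_eq_bot']
    intro x hx
    refine eq_zero_of_commute_of_adjoin_eq_top hd h hL (fun j => ?_) congr(($hx).2)
    exact sub_eq_zero.mp congr(($hx).1 j)
  obtain ⟨K, hK, hΦ⟩ := Φ.exists_antilipschitzWith hker
  have hK' : (0 : ℝ) < K := hK
  have hd' : (0 : ℝ) < d := by exact_mod_cast hd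
  -- `K²` comes from the lower bound on `Φ`, and `d²` from comparing the Hilbert–Schmidt norm with
  -- the entrywise sup norm.
  refine ⟨(2 * (d * (d * (K : ℝ) ^ 2)))⁻¹, by positivity, fun x hx => ?_⟩
  set Q := ∑ j, frobeniusSq (L j * x - x * L j) with hQ
  have hQ0 : 0 ≤ Q := Finset.sum_nonneg fun _ _ => frobeniusSq_nonneg _
  have h1 : ‖Φ x‖ ≤ √Q := by
    refine norm_prod_le_iff.mpr ⟨?_, ?_⟩
    · refine (pi_norm_le_iff_of_nonneg (Real.sqrt_nonneg _)).mpr fun j => ?_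
      rw [Real.le_sqrt (norm_nonneg _) hQ0]
      exact (norm_sq_le_frobeniusSq _).trans (Finset.single_le_sum
        (f := fun j => frobeniusSq (L j * x - x * L j)) (fun _ _ => frobeniusSq_nonneg _)
        (Finset.mem_univ j))
    · change ‖x.trace‖ ≤ _
      simp [hx]
  have h2 : ‖x‖ ≤ K * √Q := by
    have h4 := hΦ.le_mul_dist x 0
    rw [map_zero, dist_zero_right, dist_zero_right] at h4
    exact h4.trans (by gcongr)
  have h3 : frobeniusSq x ≤ d * (d * ((K : ℝ) ^ 2 * Q)) := by
    refine (frobeniusSq_le_norm_sq x).trans ?_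
    gcongr
    calc ‖x‖ ^ 2 ≤ (K * √Q) ^ 2 := by gcongr
      _ = _ := by rw [mul_pow, Real.sq_sqrt hQ0]
  rw [mul_inv, ← mul_assoc, mul_inv_cancel₀ two_ne_zero, one_mul, inv_mul_le_iff₀ (by positivity)]
  linarith

end Coercivity

end Dissipator

/-! ### The time-ordered exponential of an integrable generator -/

-- This yields the `1 / n!` in the Dyson bounds. With `ℓ` merely integrable, its primitive is
-- differentiable only almost everywhere, but powers of it are absolutely continuous, so the
-- fundamental theorem of calculus still applies.
open MeasureTheory intervalIntegral in
theorem integral_mul_primitive_pow {ℓ : ℝ → ℝ} (hℓ : ∀ a b, IntervalIntegrable ℓ volume a b)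
    (s t : ℝ) (n : ℕ) :
    ∫ u in s..t, ℓ u * (∫ v in s..u, ℓ v) ^ n = (∫ v in s..t, ℓ v) ^ (n + 1) / (n + 1) := by
  have hac : AbsolutelyContinuousOnInterval (fun u => ∫ v in s..u, ℓ v) s t :=
    (hℓ s t).absolutelyContinuousOnInterval_intervalIntegral (by simp)
  have hpow : ∀ k : ℕ,
      AbsolutelyContinuousOnInterval (fun u => (∫ v in s..u, ℓ v) ^ (k + 1)) s t := by
    intro k
    induction k with
    | zero => simpa using hac
    | succ k ih => simpa only [pow_succ _ (k + 1)] using ih.fun_mul hac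
  have h1 := (hpow n).integral_deriv_eq_sub
  simp only [integral_same, ne_eq, Nat.add_eq_zero_iff, one_ne_zero, and_false, not_false_eq_true,
    zero_pow, sub_zero] at h1
  rw [← h1, eq_div_iff (by positivity), ← intervalIntegral.integral_mul_const]
  refine integral_congr_ae ?_
  filter_upwards [(hℓ s t).ae_hasDerivAt_integral] with u hu hu'
  have h2 : deriv (fun u => (∫ v in s..u, ℓ v) ^ (n + 1)) u = _ :=
    ((hu (Set.uIoc_subset_uIcc hu') s (by simp)).pow (n + 1)).deriv
  rw [h2]
  rw [Nat.add_sub_cancel]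
  push_cast
  ring

section Evolution

open MeasureTheory intervalIntegral

attribute [local instance] Matrix.normedAddCommGroup Matrix.normedSpace

variable {d : ℕ} {𝓛 : ℝ → Matrix (Fin d) (Fin d) ℂ →ₗ[ℂ] Matrix (Fin d) (Fin d) ℂ}

/-- Entrywise integrability of a time-dependent generator on all bounded intervals. -/
def IsIntegrableGenerator
    (𝓛 : ℝ → Matrix (Fin d) (Fin d) ℂ →ₗ[ℂ] Matrix (Fin d) (Fin d) ℂ) : Prop :=
  ∀ y i j a b, IntervalIntegrable (fun u => 𝓛 u y i j) volume a b

/-- A pointwise bound for the norm of a time-dependent generator. -/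
noncomputable def generatorBound
    (𝓛 : ℝ → Matrix (Fin d) (Fin d) ℂ →ₗ[ℂ] Matrix (Fin d) (Fin d) ℂ) (u : ℝ) : ℝ :=
  ∑ i, ∑ j, ∑ k, ∑ l, ‖𝓛 u (Matrix.single k l 1) i j‖

theorem generatorBound_nonneg (u : ℝ) : 0 ≤ generatorBound 𝓛 u := by
  unfold generatorBound
  positivity

theorem IsIntegrableGenerator.intervalIntegrable_generatorBound (h : IsIntegrableGenerator 𝓛)
    (a b : ℝ) : IntervalIntegrable (generatorBound 𝓛) volume a b := by
  unfold generatorBound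
  have hs : ∀ F : Fin d → ℝ → ℝ, (∀ i, IntervalIntegrable (F i) volume a b) →
      IntervalIntegrable (fun u => ∑ i, F i u) volume a b := fun F hF => by
    simpa only [Finset.sum_fn] using IntervalIntegrable.sum Finset.univ (fun i _ => hF i)
  exact hs _ fun i => hs _ fun j => hs _ fun k => hs _ fun l => (h _ i j a b).norm

theorem linearMap_entry_eq_sum (A : Matrix (Fin d) (Fin d) ℂ →ₗ[ℂ] Matrix (Fin d) (Fin d) ℂ)
    (y : Matrix (Fin d) (Fin d) ℂ) (i j : Fin d) :
    A y i j = ∑ k, ∑ l, y k l * A (Matrix.single k l 1) i j := by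
  conv_lhs => rw [Matrix.matrix_eq_sum_single y]
  simp only [map_sum, Matrix.sum_apply]
  refine Finset.sum_congr rfl fun k _ => Finset.sum_congr rfl fun l _ => ?_
  have : Matrix.single k l (y k l) = y k l • Matrix.single k l (1 : ℂ) := by
    simp
  rw [this, map_smul, Matrix.smul_apply, smul_eq_mul]

theorem norm_generator_entry_le (u : ℝ) (y : Matrix (Fin d) (Fin d) ℂ) (i j : Fin d) :
    ‖𝓛 u y i j‖ ≤ generatorBound 𝓛 u * ‖y‖ := by
  rw [linearMap_entry_eq_sum]
  calc _ ≤ ∑ k, ∑ l, ‖𝓛 u (Matrix.single k l 1) i j‖ * ‖y‖ := by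
        refine norm_sum_le_of_le _ fun k _ => norm_sum_le_of_le _ fun l _ => ?_
        rw [norm_mul, mul_comm]
        gcongr
        exact Matrix.norm_entry_le_entrywise_sup_norm y
    _ = (∑ k, ∑ l, ‖𝓛 u (Matrix.single k l 1) i j‖) * ‖y‖ := by
        simp only [Finset.sum_mul]
    _ ≤ _ := by
        gcongr
        refine (Finset.single_le_sum (f := fun j => ∑ k, ∑ l, ‖𝓛 u (Matrix.single k l 1) i j‖)
          (fun _ _ => by positivity) (Finset.mem_univ j)).trans ?_
        exact Finset.single_le_sum
          (f := fun i => ∑ j, ∑ k, ∑ l, ‖𝓛 u (Matrix.single k l 1) i j‖)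
          (fun _ _ => by positivity) (Finset.mem_univ i)

theorem IsIntegrableGenerator.intervalIntegrable_apply (h : IsIntegrableGenerator 𝓛) {a b : ℝ}
    {y : ℝ → Matrix (Fin d) (Fin d) ℂ} (hy : ContinuousOn y (Set.uIcc a b)) (i j : Fin d) :
    IntervalIntegrable (fun u => 𝓛 u (y u) i j) volume a b := by
  have hs : ∀ F : Fin d → ℝ → ℂ, (∀ i, IntervalIntegrable (F i) volume a b) →
      IntervalIntegrable (fun u => ∑ i, F i u) volume a b := fun F hF => by
    simpa only [Finset.sum_fn] using IntervalIntegrable.sum Finset.univ (fun i _ => hF i)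
  simp only [linearMap_entry_eq_sum _ (y _)]
  refine hs _ fun k => hs _ fun l => (h _ i j a b).continuousOn_mul ?_
  exact continuousOn_pi.mp (continuousOn_pi.mp hy k) l

theorem IsIntegrableGenerator.continuous_dysonTerm (h : IsIntegrableGenerator 𝓛) (s : ℝ)
    (x : Matrix (Fin d) (Fin d) ℂ) (n : ℕ) : Continuous (dysonTerm 𝓛 s x n) := by
  induction n with
  | zero => exact continuous_const
  | succ n ih =>
    refine continuous_pi fun i => continuous_pi fun j => ?_
    exact continuous_primitive (fun a b => h.intervalIntegrable_apply ih.continuousOn i j) s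

theorem IsIntegrableGenerator.norm_dysonTerm_le (h : IsIntegrableGenerator 𝓛) {s t : ℝ}
    (hst : s ≤ t) (x : Matrix (Fin d) (Fin d) ℂ) (n : ℕ) :
    ‖dysonTerm 𝓛 s x n t‖ ≤ ‖x‖ * ((∫ u in s..t, generatorBound 𝓛 u) ^ n / n.factorial) := by
  induction n generalizing t with
  | zero => simp [dysonTerm]
  | succ n ih =>
    have hb := h.intervalIntegrable_generatorBound
    have hcont : Continuous fun u => ∫ v in s..u, generatorBound 𝓛 v := continuous_primitive hb s
    have h0 : 0 ≤ ∫ u in s..t, generatorBound 𝓛 u :=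
      integral_nonneg hst fun u _ => generatorBound_nonneg u
    refine (Matrix.norm_le_iff (by positivity)).mpr fun i j => ?_
    calc ‖∫ u in s..t, 𝓛 u (dysonTerm 𝓛 s x n u) i j‖
        ≤ ∫ u in s..t, (‖x‖ / n.factorial) *
            (generatorBound 𝓛 u * (∫ v in s..u, generatorBound 𝓛 v) ^ n) := by
          refine norm_integral_le_of_norm_le hst (ae_of_all _ fun u hu => ?_) ?_
          · refine (norm_generator_entry_le u _ i j).trans ?_
            calc _ ≤ generatorBound 𝓛 u *
                  (‖x‖ * ((∫ v in s..u, generatorBound 𝓛 v) ^ n / n.factorial)) :=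
                  mul_le_mul_of_nonneg_left (ih hu.1.le) (generatorBound_nonneg u)
              _ = _ := by ring
          · exact ((hb s t).mul_continuousOn (hcont.pow n).continuousOn).const_mul _
      _ = _ := by
          rw [intervalIntegral.integral_const_mul, integral_mul_primitive_pow hb,
            Nat.factorial_succ]
          push_cast
          field_simp

/-- A bound for the Dyson series, uniform in the final time. -/
theorem IsIntegrableGenerator.norm_dysonTerm_le_of_mem (h : IsIntegrableGenerator 𝓛) {s t u : ℝ}
    (hu : u ∈ Set.Icc s t) (x : Matrix (Fin d) (Fin d) ℂ) (n : ℕ) :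
    ‖dysonTerm 𝓛 s x n u‖ ≤ ‖x‖ * ((∫ u in s..t, generatorBound 𝓛 u) ^ n / n.factorial) := by
  refine (h.norm_dysonTerm_le hu.1 x n).trans ?_
  have hb := h.intervalIntegrable_generatorBound
  have h0 : 0 ≤ ∫ v in s..u, generatorBound 𝓛 v :=
    integral_nonneg hu.1 fun u _ => generatorBound_nonneg u
  gcongr
  rw [← integral_add_adjacent_intervals (hb s u) (hb u t)]
  exact le_add_of_nonneg_right (integral_nonneg hu.2 fun u _ => generatorBound_nonneg u)

theorem summable_dysonBound (x : Matrix (Fin d) (Fin d) ℂ) (r : ℝ) :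
    Summable fun n : ℕ => ‖x‖ * (r ^ n / n.factorial) :=
  (Real.summable_pow_div_factorial r).mul_left _

theorem IsIntegrableGenerator.hasSum_timeEvolution (h : IsIntegrableGenerator 𝓛) {s t : ℝ}
    (hst : s ≤ t) (x : Matrix (Fin d) (Fin d) ℂ) :
    HasSum (fun n => dysonTerm 𝓛 s x n t) (timeEvolution 𝓛 t s x) :=
  (Summable.of_norm_bounded (summable_dysonBound x _) (h.norm_dysonTerm_le hst x)).hasSum

theorem IsIntegrableGenerator.continuousOn_timeEvolution (h : IsIntegrableGenerator 𝓛) {s t : ℝ}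
    (x : Matrix (Fin d) (Fin d) ℂ) :
    ContinuousOn (fun u => timeEvolution 𝓛 u s x) (Set.Icc s t) :=
  continuousOn_tsum (fun n => (h.continuous_dysonTerm s x n).continuousOn)
    (summable_dysonBound x (∫ u in s..t, generatorBound 𝓛 u))
    fun n _ hu => h.norm_dysonTerm_le_of_mem hu x n

/-- The time-ordered exponential solves the integrated master equation. -/
theorem IsIntegrableGenerator.timeEvolution_eq_add_integral (h : IsIntegrableGenerator 𝓛)
    {s t : ℝ} (hst : s ≤ t) (x : Matrix (Fin d) (Fin d) ℂ) (i j : Fin d) :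
    timeEvolution 𝓛 t s x i j = x i j + ∫ u in s..t, 𝓛 u (timeEvolution 𝓛 u s x) i j := by
  have h1 : HasSum (fun n => dysonTerm 𝓛 s x n t i j) (timeEvolution 𝓛 t s x i j) :=
    Pi.hasSum.mp (Pi.hasSum.mp (h.hasSum_timeEvolution hst x) i) j
  have h2 : HasSum (fun n => dysonTerm 𝓛 s x (n + 1) t i j)
      (∫ u in s..t, 𝓛 u (timeEvolution 𝓛 u s x) i j) := by
    -- Integrating `𝓛` applied to the `n`-th Dyson term gives term `n + 1`, so the integrated series
    -- lacks only the zeroth term `x`.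
    refine hasSum_integral_of_dominated_convergence
      (fun n u => generatorBound 𝓛 u *
        (‖x‖ * ((∫ u in s..t, generatorBound 𝓛 u) ^ n / n.factorial))) ?_ ?_ ?_ ?_ ?_
    · intro n
      exact (h.intervalIntegrable_apply
        (h.continuous_dysonTerm s x n).continuousOn i j).aestronglyMeasurable_restrict_uIoc
    · refine fun n => ae_of_all _ fun u hu => ?_
      rw [Set.uIoc_of_le hst] at hu
      exact (norm_generator_entry_le u _ i j).trans (mul_le_mul_of_nonneg_left
        (h.norm_dysonTerm_le_of_mem ⟨hu.1.le, hu.2⟩ x n) (generatorBound_nonneg u))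
    · exact ae_of_all _ fun u _ => (summable_dysonBound x _).mul_left _
    · simp only [tsum_mul_left]
      exact (h.intervalIntegrable_generatorBound s t).mul_const _
    · refine ae_of_all _ fun u hu => ?_
      rw [Set.uIoc_of_le hst] at hu
      have h3 := (h.hasSum_timeEvolution hu.1.le x).map (𝓛 u)
        (LinearMap.continuous_of_finiteDimensional (𝓛 u))
      exact Pi.hasSum.mp (Pi.hasSum.mp h3 i) j
  have h4 := ((hasSum_nat_add_iff' 1).mpr h1).unique h2
  rw [← h4]
  simp [dysonTerm]

theorem IsIntegrableGenerator.trace_timeEvolution (h : IsIntegrableGenerator 𝓛)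
    (htr : ∀ u y, (𝓛 u y).trace = 0) {s t : ℝ} (hst : s ≤ t) (x : Matrix (Fin d) (Fin d) ℂ) :
    (timeEvolution 𝓛 t s x).trace = x.trace := by
  have h1 : (timeEvolution 𝓛 t s x).trace =
      ∑ i, (x i i + ∫ u in s..t, 𝓛 u (timeEvolution 𝓛 u s x) i i) :=
    Finset.sum_congr rfl fun i _ => h.timeEvolution_eq_add_integral hst x i i
  rw [h1, Finset.sum_add_distrib, ← intervalIntegral.integral_finsetSum]
  · have h2 : ∀ u, ∑ i, 𝓛 u (timeEvolution 𝓛 u s x) i i = 0 := fun u => htr u _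
    simp [h2, Matrix.trace]
  · intro i _
    refine h.intervalIntegrable_apply ?_ i i
    rw [Set.uIcc_of_le hst]
    exact h.continuousOn_timeEvolution x

/-! ### Absolutely continuous Grönwall estimate and Hilbert–Schmidt decay -/

theorem AbsolutelyContinuousOnInterval.congr_on {f g : ℝ → ℝ} {a b : ℝ}
    (hf : AbsolutelyContinuousOnInterval f a b) (hfg : ∀ u ∈ Set.uIcc a b, f u = g u) :
    AbsolutelyContinuousOnInterval g a b := by
  rw [absolutelyContinuousOnInterval_iff] at hf ⊢
  intro ε hε
  obtain ⟨δ, hδ, h⟩ := hf ε hε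
  refine ⟨δ, hδ, fun E hE hlt => ?_⟩
  refine (Finset.sum_congr rfl fun i hi => ?_).trans_lt (h E hE hlt)
  rw [hfg _ (hE.1 i hi).1, hfg _ (hE.1 i hi).2]

theorem absolutelyContinuousOnInterval_sum {ι : Type*} (S : Finset ι) {F : ι → ℝ → ℝ} {a b : ℝ}
    (hF : ∀ i ∈ S, AbsolutelyContinuousOnInterval (F i) a b) :
    AbsolutelyContinuousOnInterval (fun u => ∑ i ∈ S, F i u) a b := by
  classical
  induction S using Finset.induction_on with
  | empty =>
    simpa using (LipschitzOnWith.of_dist_le_mul (K := 0) (f := fun _ : ℝ => (0 : ℝ))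
      (s := Set.uIcc a b) (by simp)).absolutelyContinuousOnInterval
  | insert i S hi ih =>
    simp only [Finset.sum_insert hi]
    exact (hF i (Finset.mem_insert_self _ _)).fun_add
      (ih fun k hk => hF k (Finset.mem_insert_of_mem hk))

/-- Grönwall's inequality for absolutely continuous functions, in the decaying case. -/
theorem AbsolutelyContinuousOnInterval.le_exp_mul_of_ae_hasDerivAt {E E' : ℝ → ℝ} {s t γ : ℝ}
    (hst : s ≤ t) (hE : AbsolutelyContinuousOnInterval E s t)
    (hd : ∀ᵐ u, u ∈ Set.uIcc s t → HasDerivAt E (E' u) u)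
    (hle : ∀ u ∈ Set.Icc s t, E' u ≤ -γ * E u) :
    E t ≤ Real.exp (-γ * (t - s)) * E s := by
  -- Integrating factor: `exp (γ u) * E u` is absolutely continuous with almost everywhere
  -- nonpositive derivative, so it does not increase from `s` to `t`.
  have hexp : AbsolutelyContinuousOnInterval (fun u => Real.exp (γ * u)) s t :=
    ContDiffOn.absolutelyContinuousOnInterval
      (ContDiff.contDiffOn (Real.contDiff_exp.comp (contDiff_const.mul contDiff_id)))
  have h1 := (hexp.fun_mul hE).integral_deriv_eq_sub
  have h2 : 0 ≤ ∫ u in s..t, -deriv (fun u => Real.exp (γ * u) * E u) u := by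
    refine integral_nonneg_of_ae_restrict hst ?_
    rw [Filter.EventuallyLE, ae_restrict_iff' measurableSet_Icc]
    filter_upwards [hd] with u hu hu'
    have h3 := ((hasDerivAt_id u).const_mul γ).exp.mul (hu (by rwa [Set.uIcc_of_le hst]))
    have h4 : deriv (fun u => Real.exp (γ * u) * E u) u =
      Real.exp (γ * u) * (γ * 1) * E u + Real.exp (γ * u) * E' u := h3.deriv
    rw [h4]
    have h5 := mul_nonneg (Real.exp_pos (γ * u)).le (sub_nonneg.mpr (hle u hu'))
    simp only [Pi.zero_apply]
    linarith
  rw [intervalIntegral.integral_neg, h1] at h2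
  have h6 : Real.exp (γ * t) * E t ≤ Real.exp (γ * s) * E s := by linarith
  calc E t = Real.exp (-γ * t) * (Real.exp (γ * t) * E t) := by
        rw [← mul_assoc, ← Real.exp_add]; simp
    _ ≤ Real.exp (-γ * t) * (Real.exp (γ * s) * E s) := by gcongr
    _ = _ := by rw [← mul_assoc, ← Real.exp_add]; congr 2; ring

theorem re_trace_conjTranspose_mul (x y : Matrix (Fin d) (Fin d) ℂ) :
    (xᴴ * y).trace.re = ∑ i, ∑ j, ((x i j).re * (y i j).re + (x i j).im * (y i j).im) := by
  simp only [Matrix.trace, Matrix.diag, Matrix.mul_apply, Matrix.conjTranspose_apply,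
    Complex.re_sum]
  rw [Finset.sum_comm]
  refine Finset.sum_congr rfl fun i _ => Finset.sum_congr rfl fun j _ => ?_
  simp [Complex.mul_re]

theorem frobeniusSq_eq_sum_re_im (x : Matrix (Fin d) (Fin d) ℂ) :
    frobeniusSq x = ∑ i, ∑ j, ((x i j).re * (x i j).re + (x i j).im * (x i j).im) := by
  refine Finset.sum_congr rfl fun i _ => Finset.sum_congr rfl fun j _ => ?_
  rw [← Complex.normSq_eq_norm_sq, Complex.normSq_apply]

/-- A dissipative time-dependent generator has exponentially decaying time evolution in the
Hilbert–Schmidt norm, on an invariant set where the dissipation has a gap. -/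
theorem IsIntegrableGenerator.frobeniusSq_timeEvolution_le (h : IsIntegrableGenerator 𝓛)
    {s t γ : ℝ} (hst : s ≤ t) (x : Matrix (Fin d) (Fin d) ℂ)
    (hdiss : ∀ u ∈ Set.Icc s t, 2 * ((timeEvolution 𝓛 u s x)ᴴ *
      𝓛 u (timeEvolution 𝓛 u s x)).trace.re ≤ -γ * frobeniusSq (timeEvolution 𝓛 u s x)) :
    frobeniusSq (timeEvolution 𝓛 t s x) ≤ Real.exp (-γ * (t - s)) * frobeniusSq x := by
  let f : ℝ → Matrix (Fin d) (Fin d) ℂ := fun u => 𝓛 u (timeEvolution 𝓛 u s x)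
  have hf : ∀ i j, IntervalIntegrable (fun u => f u i j) volume s t := fun i j =>
    h.intervalIntegrable_apply (by
      rw [Set.uIcc_of_le hst]; exact h.continuousOn_timeEvolution x) i j
  -- The integral equation is available only for times `u ≥ s`; `Y` extends its right-hand side to
  -- all real `u`, so that two-sided derivatives make sense.
  let Y : ℝ → Matrix (Fin d) (Fin d) ℂ := fun u => Matrix.of fun i j =>
    x i j + ∫ v in s..u, f v i j
  have hY : ∀ u ∈ Set.Icc s t, Y u = timeEvolution 𝓛 u s x := fun u hu => by
    ext i j
    exact (h.timeEvolution_eq_add_integral hu.1 x i j).symm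
  have hYs : Y s = x := by ext i j; simp [Y]
  have hac : ∀ L : ℂ →L[ℝ] ℝ, ∀ i j,
      AbsolutelyContinuousOnInterval (fun u => L (Y u i j)) s t := by
    intro L i j
    have hLf : IntervalIntegrable (fun u => L (f u i j)) volume s t :=
      ⟨L.integrable_comp (hf i j).1, L.integrable_comp (hf i j).2⟩
    have h1 : AbsolutelyContinuousOnInterval (fun u => ∫ v in s..u, L (f v i j)) s t :=
      hLf.absolutelyContinuousOnInterval_intervalIntegral (by simp)
    have h2 : AbsolutelyContinuousOnInterval (fun _ : ℝ => L (x i j)) s t :=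
      (LipschitzOnWith.of_dist_le_mul (K := 0) (s := Set.uIcc s t)
        (by simp)).absolutelyContinuousOnInterval
    refine (h2.fun_add h1).congr_on fun u hu => ?_
    have h3 : Set.uIcc s u ⊆ Set.uIcc s t := Set.uIcc_subset_uIcc_left hu
    rw [L.intervalIntegral_comp_comm ((hf i j).mono_set h3), ← map_add]
    rfl
  have hE : AbsolutelyContinuousOnInterval (fun u => frobeniusSq (Y u)) s t := by
    simp only [frobeniusSq_eq_sum_re_im]
    refine absolutelyContinuousOnInterval_sum _ fun i _ =>
      absolutelyContinuousOnInterval_sum _ fun j _ => ?_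
    exact ((hac Complex.reCLM i j).fun_mul (hac Complex.reCLM i j)).fun_add
      ((hac Complex.imCLM i j).fun_mul (hac Complex.imCLM i j))
  have hderiv : ∀ᵐ u, u ∈ Set.uIcc s t →
      HasDerivAt (fun u => frobeniusSq (Y u)) (2 * ((Y u)ᴴ * f u).trace.re) u := by
    have h1 : ∀ᵐ u, ∀ i j, u ∈ Set.uIcc s t → HasDerivAt (fun u => Y u i j) (f u i j) u := by
      refine ae_all_iff.mpr fun i => ae_all_iff.mpr fun j => ?_
      filter_upwards [(hf i j).ae_hasDerivAt_integral] with u hu hu'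
      exact (hu hu' s (by simp)).const_add _
    filter_upwards [h1] with u hu hu'
    simp only [frobeniusSq_eq_sum_re_im, re_trace_conjTranspose_mul, Finset.mul_sum]
    refine HasDerivAt.fun_sum fun i _ => HasDerivAt.fun_sum fun j _ => ?_
    have hre : HasDerivAt (fun u => (Y u i j).re) (f u i j).re u :=
      Complex.reCLM.hasFDerivAt.comp_hasDerivAt u (hu i j hu')
    have him : HasDerivAt (fun u => (Y u i j).im) (f u i j).im u :=
      Complex.imCLM.hasFDerivAt.comp_hasDerivAt u (hu i j hu')
    refine ((hre.mul hre).add (him.mul him)).congr_deriv ?_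
    ring
  have := hE.le_exp_mul_of_ae_hasDerivAt (γ := γ) hst hderiv fun u hu => by
    rw [hY u hu]
    exact hdiss u hu
  rwa [hYs, hY t ⟨hst, le_rfl⟩] at this

end Evolution

/-! ### Trace-norm contractivity and uniqueness of the fixed state -/

section Contractivity

variable {d m : ℕ}

theorem traceNorm_nonneg (A : Matrix (Fin d) (Fin d) ℂ) : 0 ≤ traceNorm A :=
  Finset.sum_nonneg fun _ _ => Real.sqrt_nonneg _

theorem sum_eigenvalues_eq_frobeniusSq (A : Matrix (Fin d) (Fin d) ℂ) :
    ∑ k, (Matrix.isHermitian_conjTranspose_mul_self A).eigenvalues k = frobeniusSq A := by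
  have h := (Matrix.isHermitian_conjTranspose_mul_self A).trace_eq_sum_eigenvalues
  rw [trace_conjTranspose_mul_self] at h
  exact Complex.ofReal_injective (by simpa using h.symm)

theorem eigenvalues_conjTranspose_mul_self_nonneg (A : Matrix (Fin d) (Fin d) ℂ) (k : Fin d) :
    0 ≤ (Matrix.isHermitian_conjTranspose_mul_self A).eigenvalues k :=
  (Matrix.posSemidef_conjTranspose_mul_self A).eigenvalues_nonneg k

theorem frobeniusSq_le_traceNorm_sq (A : Matrix (Fin d) (Fin d) ℂ) :
    frobeniusSq A ≤ traceNorm A ^ 2 := by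
  rw [← sum_eigenvalues_eq_frobeniusSq]
  calc _ = ∑ k, √((Matrix.isHermitian_conjTranspose_mul_self A).eigenvalues k) ^ 2 :=
        Finset.sum_congr rfl fun k _ =>
          (Real.sq_sqrt (eigenvalues_conjTranspose_mul_self_nonneg A k)).symm
    _ ≤ _ := Finset.sum_sq_le_sq_sum_of_nonneg fun _ _ => Real.sqrt_nonneg _

/-- Cauchy–Schwarz over the `d` singular values; this is the source of the prefactor `√d`. -/
theorem traceNorm_sq_le (A : Matrix (Fin d) (Fin d) ℂ) :
    traceNorm A ^ 2 ≤ d * frobeniusSq A := by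
  rw [← sum_eigenvalues_eq_frobeniusSq]
  calc traceNorm A ^ 2
      ≤ (Finset.univ : Finset (Fin d)).card *
        ∑ k, √((Matrix.isHermitian_conjTranspose_mul_self A).eigenvalues k) ^ 2 :=
        sq_sum_le_card_mul_sum_sq
    _ = _ := by
      rw [Finset.card_univ, Fintype.card_fin]
      congr 1
      exact Finset.sum_congr rfl fun k _ =>
          Real.sq_sqrt (eigenvalues_conjTranspose_mul_self_nonneg A k)

theorem eq_zero_of_traceNorm_eq_zero {A : Matrix (Fin d) (Fin d) ℂ} (h : traceNorm A = 0) :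
    A = 0 :=
  frobeniusSq_eq_zero (le_antisymm (by simpa [h] using frobeniusSq_le_traceNorm_sq A)
    (frobeniusSq_nonneg A))

theorem trace_dissipator (L : Fin m → Matrix (Fin d) (Fin d) ℂ) (x : Matrix (Fin d) (Fin d) ℂ) :
    (dissipator L x).trace = 0 := by
  rw [dissipator_apply, Matrix.trace_sum]
  refine Finset.sum_eq_zero fun j _ => ?_
  rw [Matrix.trace_sub, Matrix.trace_smul, Matrix.trace_add, Matrix.trace_mul_comm (L j * x),
    Matrix.trace_mul_comm x, Matrix.mul_assoc]
  simp only [smul_eq_mul]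
  ring

theorem trace_drivenLindbladian (H : ℝ → Matrix (Fin d) (Fin d) ℂ)
    (L : Fin m → Matrix (Fin d) (Fin d) ℂ) (t : ℝ) (x : Matrix (Fin d) (Fin d) ℂ) :
    (drivenLindbladian H (dissipator L) t x).trace = 0 := by
  simp [drivenLindbladian, hamiltonianPart, trace_dissipator, Matrix.trace_mul_comm x]

/-- `x† H x` and `x H x†` are Hermitian with real traces, so the factor `-i` makes the expression
purely imaginary. Hence no drive affects the Hilbert–Schmidt estimate. -/
theorem re_trace_conjTranspose_mul_hamiltonianPart {H : Matrix (Fin d) (Fin d) ℂ}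
    (hH : H.IsHermitian) (x : Matrix (Fin d) (Fin d) ℂ) :
    (xᴴ * hamiltonianPart H x).trace.re = 0 := by
  have h1 : ∀ K : Matrix (Fin d) (Fin d) ℂ, K.IsHermitian → K.trace.im = 0 := fun K hK => by
    rw [← Complex.conj_eq_iff_im, ← RCLike.star_def, ← Matrix.trace_conjTranspose, hK.eq]
  have h2 : (xᴴ * (H * x)).IsHermitian := by
    simp [Matrix.IsHermitian, Matrix.conjTranspose_mul, hH.eq, Matrix.mul_assoc]
  have h5 : (xᴴ * hamiltonianPart H x).trace =
      -Complex.I * ((xᴴ * (H * x)).trace - (xᴴ * (x * H)).trace) := by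
    simp [hamiltonianPart, mul_sub, Matrix.trace_sub]
    ring
  have h6 : (xᴴ * (x * H)).trace.im = 0 := by
    have h7 : (xᴴ * (x * H)).trace = (x * H * xᴴ).trace := Matrix.trace_mul_comm _ _
    rw [h7]
    exact h1 _ (by simp [Matrix.IsHermitian, Matrix.conjTranspose_mul, hH.eq, Matrix.mul_assoc])
  rw [h5]
  simp [Complex.mul_re, h1 _ h2, h6]

theorem isIntegrableGenerator_drivenLindbladian {H : ℝ → Matrix (Fin d) (Fin d) ℂ}
    (hH : IsDrivingHamiltonian H)
    (D : Matrix (Fin d) (Fin d) ℂ →ₗ[ℂ] Matrix (Fin d) (Fin d) ℂ) :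
    IsIntegrableGenerator (drivenLindbladian H D) := by
  intro y i j a b
  have hint : ∀ i j, IntervalIntegrable (fun t => H t i j) MeasureTheory.volume a b :=
    fun i j =>
      MeasureTheory.IntegrableOn.intervalIntegrable ((hH.2 i j).integrableOn_isCompact
        isCompact_uIcc)
  have hs : ∀ F : Fin d → ℝ → ℂ, (∀ i, IntervalIntegrable (F i) MeasureTheory.volume a b) →
      IntervalIntegrable (fun u => ∑ i, F i u) MeasureTheory.volume a b := fun F hF => by
    simpa only [Finset.sum_fn] using IntervalIntegrable.sum Finset.univ (fun i _ => hF i)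
  have h1 : (fun u => drivenLindbladian H D u y i j) = fun u =>
      -Complex.I * ((∑ k, H u i k * y k j) - ∑ k, y i k * H u k j) + D y i j := by
    funext u
    simp [drivenLindbladian, hamiltonianPart, Matrix.mul_apply]
  rw [h1]
  exact (((hs _ fun k => (hint i k).mul_const _).sub
    (hs _ fun k => (hint k j).const_mul _)).const_mul _).add intervalIntegrable_const

/-- A gap of the dissipation on traceless matrices gives contractivity under every drive. -/
theorem isHamiltonianIndependentlyContractive_of_adjoin_eq_top (hd : 0 < d)
    {L : Fin m → Matrix (Fin d) (Fin d) ℂ} (h : dissipator L 1 = 0)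
    (hL : Algebra.adjoin ℂ (Set.range L ∪ Set.range fun j => (L j)ᴴ) = ⊤) :
    IsHamiltonianIndependentlyContractive (dissipator L) := by
  obtain ⟨γ, hγ, hgap⟩ := exists_gap hd h hL
  intro H hH
  have hint := isIntegrableGenerator_drivenLindbladian hH (dissipator L)
  have hd' : (0 : ℝ) < d := by exact_mod_cast hd
  -- The squared norm decays at rate `2γ`, hence the norm at rate `γ`; neither constant depends on
  -- `H`.
  refine ⟨√d, γ, Real.sqrt_pos.mpr hd', hγ, fun ρ σ hρ hσ s t _ hst => ?_⟩
  have htr : (ρ - σ).trace = 0 := by rw [Matrix.trace_sub, hρ.2, hσ.2, sub_self]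
  have h1 := hint.frobeniusSq_timeEvolution_le (γ := 2 * γ) hst (ρ - σ) fun u hu => by
    set x := timeEvolution (drivenLindbladian H (dissipator L)) u s (ρ - σ)
    have h2 : x.trace = 0 :=
      (hint.trace_timeEvolution (trace_drivenLindbladian H L) hu.1 _).trans htr
    have h3 := hgap x h2
    rw [sum_frobeniusSq_commutator h] at h3
    rw [drivenLindbladian, LinearMap.add_apply, mul_add, Matrix.trace_add, Complex.add_re,
      re_trace_conjTranspose_mul_hamiltonianPart (hH.1 u)]
    linarith
  refine le_of_sq_le_sq ?_ (mul_nonneg (by positivity) (traceNorm_nonneg _))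
  calc _ ≤ d * frobeniusSq (timeEvolution (drivenLindbladian H (dissipator L)) t s (ρ - σ)) :=
        traceNorm_sq_le _
    _ ≤ d * (Real.exp (-(2 * γ) * (t - s)) * traceNorm (ρ - σ) ^ 2) := by
        gcongr
        exact h1.trans (by gcongr; exact frobeniusSq_le_traceNorm_sq _)
    _ = _ := by
        rw [mul_pow, mul_pow, Real.sq_sqrt hd'.le, ← Real.exp_nat_mul,
          abs_of_nonneg (sub_nonneg.mpr hst), mul_assoc]
        congr 3
        push_cast
        ring

theorem timeEvolution_of_forall_apply_eq_zero
    {𝓛 : ℝ → Matrix (Fin d) (Fin d) ℂ →ₗ[ℂ] Matrix (Fin d) (Fin d) ℂ}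
    {x : Matrix (Fin d) (Fin d) ℂ} (hx : ∀ u, 𝓛 u x = 0) (t s : ℝ) :
    timeEvolution 𝓛 t s x = x := by
  have h1 : ∀ n t, dysonTerm 𝓛 s x (n + 1) t = 0 := by
    intro n
    induction n with
    | zero => intro t; ext i j; simp [dysonTerm, hx]
    | succ n ih =>
      intro t
      rw [dysonTerm]
      ext i j
      simp [ih]
  exact tsum_eq_single 0 fun n hn => by
    obtain ⟨k, rfl⟩ := Nat.exists_eq_succ_of_ne_zero hn
    exact h1 k t

theorem eq_maximallyMixed_of_contractive (hd : 0 < d) {L : Fin m → Matrix (Fin d) (Fin d) ℂ}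
    (h : dissipator L 1 = 0) (hc : IsHamiltonianIndependentlyContractive (dissipator L))
    {ρ : Matrix (Fin d) (Fin d) ℂ} (hρ : IsFixedState (dissipator L) ρ) :
    ρ = maximallyMixed d := by
  obtain ⟨K, γ, hK, hγ, hcon⟩ := hc (fun _ => 0)
    ⟨fun _ => Matrix.isHermitian_zero, fun _ _ => MeasureTheory.locallyIntegrable_const _⟩
  have hτ := isFixedState_maximallyMixed hd h
  have hev := timeEvolution_of_forall_apply_eq_zero
    (𝓛 := drivenLindbladian (fun _ => 0) (dissipator L)) (x := ρ - maximallyMixed d)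
    fun u => by
      simp [drivenLindbladian, hamiltonianPart, hρ.2, hτ.2]
  have hle : ∀ t : ℝ, 0 ≤ t → traceNorm (ρ - maximallyMixed d) ≤
      K * Real.exp (-γ * t) * traceNorm (ρ - maximallyMixed d) := fun t ht => by
    have h1 := hcon ρ (maximallyMixed d) hρ.1 hτ.1 0 t le_rfl ht
    rwa [hev, sub_zero, abs_of_nonneg ht] at h1
  have hlim : Filter.Tendsto
      (fun t : ℝ => K * Real.exp (-γ * t) * traceNorm (ρ - maximallyMixed d))
      Filter.atTop (nhds 0) := by
    have h1 : Filter.Tendsto (fun t : ℝ => Real.exp (-γ * t)) Filter.atTop (nhds 0) :=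
      Real.tendsto_exp_atBot.comp
        (Filter.tendsto_id.const_mul_atTop_of_neg (neg_lt_zero.mpr hγ))
    simpa using (h1.const_mul K).mul_const (traceNorm (ρ - maximallyMixed d))
  -- A fixed number bounded by a quantity tending to `0` is nonpositive.
  have h0 := ge_of_tendsto hlim (Filter.eventually_atTop.mpr ⟨0, fun t ht => hle t ht⟩)
  exact sub_eq_zero.mp (eq_zero_of_traceNorm_eq_zero (le_antisymm h0 (traceNorm_nonneg _)))

end Contractivity

theorem mainTheorem6 (d m : ℕ) (hd : 0 < d) (L : Fin m → Matrix (Fin d) (Fin d) ℂ)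
    (hunital : dissipator L 1 = 0) :
    List.TFAE [
      IsHamiltonianIndependentlyContractive (dissipator L),
      IsFixedState (dissipator L) (maximallyMixed d) ∧
        ∀ ρ, IsFixedState (dissipator L) ρ → ρ = maximallyMixed d,
      Algebra.adjoin ℂ (Set.range L ∪ Set.range fun j => (L j)ᴴ) = ⊤] := by
  tfae_have 1 → 2 := fun hc =>
    ⟨isFixedState_maximallyMixed hd hunital, fun _ hρ =>
      eq_maximallyMixed_of_contractive hd hunital hc hρ⟩
  tfae_have 2 → 3 := fun hu => adjoin_eq_top_of_unique_fixedState hunital hu.2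
  tfae_have 3 → 1 := isHamiltonianIndependentlyContractive_of_adjoin_eq_top hd hunital
  tfae_finish
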